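/- Let $\Sigma$ be the sphere $\partial\mathcal S$ with its four cone points removed, presented as $(\mathbb R^2\setminus\mathbb Z^2)/\Gamma$, where $\Gamma$ is generated by the rotations through $\pi$ about the points of $\mathbb Z^2$. The strip $0\le x\le 1$ with $y$ taken modulo $2$, and with its edges $x=0$ and $x=1$ folded by $y\mapsto -y$, is a fundamental domain. The cone points are the images of $(0,0),(0,1)$ (the negative and positive ends of the axis of $K_0$) and of $(1,0),(1,1)$ (the negative and positive ends of the axis of $K_1$). The meridian $\partial m$ is the circle $x=\tfrac12$; it separates $\Sigma$ into two halves, and $y\mapsto -y$ exchanges front ($0\le y\le1$) and back. Closed curves are unoriented and are considered up to free homotopy in $\Sigma$. For coprime integers $p,q$ with $q>0$, let $\gamma_{p/q}$ be the closed curve which outside a collar of $\partial m$ consists, in each half, of $q$ front-to-back symmetric arcs joining the meridian to itself (the arcs at heights $\pm(2k+1)/(2q)$). Each side of the collar thus has $2q$ endpoints $X^k$, $k\in\mathbb Z/2q$, numbered upwards (as seen on the front) from the foot $y=0$ of the perpendicular from the negative cone point, and across the collar the endpoint $X^k$ on the left is joined to $X^{k+p}$ on the right. So $\gamma_{p/q}$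 meets $\partial m$ in $2q$ points and has twist $p$. Put $\gamma_{1/0}=\gamma_{-1/0}=\partial m$. The $\mathcal S$-tree of curves is defined as follows. The initial vertex carries the triple $(\gamma_{1/0},\gamma_{0/1},\gamma_{1/1})$ with Farey labels $1/0,\,0/1,\,1/1$. Write $D$ for the twist about $\partial m$: it is the identity on the left side of the collar of $\partial m$, the half turn interchanging the two cone points on the right side, and interpolates across the collar by a half turn (upwards on the front), so that $D^2$ is the full Dehn twist about $\partial m$. The twist about a curve $g(\partial m)$, with $g$ an orientation-preserving homeomorphism of $\Sigma$, is $gDg^{-1}$. A vertex whose triple is $(f(\gamma_{1/0}),f(\gamma_{0/1}),f(\gamma_{1/1}))$, with $f$ the homeomorphism produced by the moves so far, and whose labels are $u,\ v,\ u+v$ (Farey addition, with $u,v$ written as integer vectors up to sign), is joined to the vertices obtained by applying to this triple the twist about its first curve (constructed with $g=f$) or about its second curve (constructed with $g=f\circ R$, where $R$ is the quarter turn $(x,y)\mapsto(-y,x)$, which takes $\partial m$ to $\gamma_{0/1}$), in either direction. The two twists about the first curve give the labels $(u,\,v+u,\,2u+v)$ and $(u,\,v-u,\,v)$; the two about the second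 give $(u-v,\,v,\,u)$ and $(u+v,\,v,\,u+2v)$. In particular $\delta_{1/1}$ and $\delta_{-1/1}$ are the two twists of $\delta_{0/1}$ about $\delta_{1/0}$. A curve is in Farey position $p/q$ if it carries the label $p/q$ at some vertex. Then for all coprime integers $p,q$ with $q\ge 0$ there is a curve $\delta_{p/q}$ in Farey position $p/q$, and every curve $\delta_{p/q}$ in Farey position $p/q$, at whichever vertex of the tree it occurs, is freely homotopic in $\Sigma$, as an unoriented curve, to $\gamma_{p/q}$: $$\delta_{p/q}=\gamma_{p/q}.$$ -/

import Mathlib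

noncomputable section

namespace FareyCurves

/-! ## The sphere with four cone points

The boundary sphere, with its four order-three cone points removed, is the quotient of the
plane punctured at the integer lattice by the group generated by the rotations through `π` about
the lattice points.  The strip `0 ≤ x ≤ 1`, `y` modulo `2`, with the two edges `x = 0` and `x = 1`
folded by `y ↦ -y`, is a fundamental domain.  The cone points are the images of `(0,0), (0,1)`
(the negative and positive ends of the first axis) and of `(1,0), (1,1)` (the negative and positive
ends of the second axis).  The meridian is the circle `x = 1/2`; the two halves of the sphere are
`0 ≤ x ≤ 1/2` and `1/2 ≤ x ≤ 1`; the front is `0 ≤ y ≤ 1`, the back is `-1 ≤ y ≤ 0`, and they are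
interchanged by `y ↦ -y`. -/

/-- The plane with the integer lattice points removed. -/
abbrev PuncturedPlane : Type :=
  {v : ℝ × ℝ // ∀ m n : ℤ, v ≠ ((m : ℝ), (n : ℝ))}

/-- Two points are equivalent when they differ by a translation by a vector of `2ℤ²`, or by a
rotation through `π` about a lattice point. -/
def pillowSetoid : Setoid PuncturedPlane where
  r v w := ∃ m n : ℤ,
    (w.1.1 = v.1.1 + 2 * m ∧ w.1.2 = v.1.2 + 2 * n) ∨
    (w.1.1 = -v.1.1 + 2 * m ∧ w.1.2 = -v.1.2 + 2 * n)
  iseqv :=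
    { refl := fun v => ⟨0, 0, Or.inl (by simp)⟩
      symm := by
        rintro v w ⟨m, n, ⟨h1, h2⟩ | ⟨h1, h2⟩⟩
        · exact ⟨-m, -n, Or.inl ⟨by push_cast; linarith, by push_cast; linarith⟩⟩
        · exact ⟨m, n, Or.inr ⟨by linarith, by linarith⟩⟩
      trans := by
        rintro u v w ⟨m, n, ⟨h1, h2⟩ | ⟨h1, h2⟩⟩ ⟨m', n', ⟨h3, h4⟩ | ⟨h3, h4⟩⟩
        · exact ⟨m + m', n + n', Or.inl ⟨by push_cast; linarith, by push_cast; linarith⟩⟩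
        · exact ⟨m' - m, n' - n, Or.inr ⟨by push_cast; linarith, by push_cast; linarith⟩⟩
        · exact ⟨m + m', n + n', Or.inr ⟨by push_cast; linarith, by push_cast; linarith⟩⟩
        · exact ⟨m' - m, n' - n, Or.inl ⟨by push_cast; linarith, by push_cast; linarith⟩⟩ }

/-- The sphere minus its four cone points. -/
def Sphere4 : Type := Quotient pillowSetoid

instance : TopologicalSpace Sphere4 :=
  inferInstanceAs (TopologicalSpace (Quotient pillowSetoid))

/-- The projection of the punctured plane onto the four-punctured sphere. -/
def proj (v : PuncturedPlane) : Sphere4 := Quotient.mk pillowSetoid v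

theorem continuous_proj : Continuous proj := continuous_quotient_mk'

/-- A homeomorphism of the punctured plane that respects the equivalence relation induces a
homeomorphism of the four-punctured sphere. -/
def descend (F : PuncturedPlane ≃ₜ PuncturedPlane)
    (h : ∀ v w, pillowSetoid.r v w → pillowSetoid.r (F v) (F w))
    (h' : ∀ v w, pillowSetoid.r v w → pillowSetoid.r (F.symm v) (F.symm w)) :
    Sphere4 ≃ₜ Sphere4 where
  toFun := Quotient.map F h
  invFun := Quotient.map F.symm h'
  left_inv := by
    intro x
    induction x using Quotient.inductionOn with
    | h v => exact congrArg (Quotient.mk pillowSetoid) (F.symm_apply_apply v)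
  right_inv := by
    intro x
    induction x using Quotient.inductionOn with
    | h v => exact congrArg (Quotient.mk pillowSetoid) (F.apply_symm_apply v)
  continuous_toFun := F.continuous.quotient_map' h
  continuous_invFun := F.symm.continuous.quotient_map' h'

/-! ## Closed curves -/

/-- Closed curves, parametrised by `ℝ / ℤ`, in the complement of the cone points. -/
abbrev ClosedCurve : Type := C(AddCircle (1 : ℝ), Sphere4)

/-- The closed curve traversed backwards. -/
def reverse (c : ClosedCurve) : ClosedCurve := c.comp ⟨fun t => -t, continuous_neg⟩

/-- Two curves agree, as unoriented curves up to free homotopy in the complement of the cone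
points. -/
def SameCurve (c d : ClosedCurve) : Prop := c.Homotopic d ∨ c.Homotopic (reverse d)

/-- The image of a closed curve under a homeomorphism of the four-punctured sphere. -/
def image (f : Sphere4 ≃ₜ Sphere4) (c : ClosedCurve) : ClosedCurve :=
  (f : C(Sphere4, Sphere4)).comp c

/-- A path in the punctured plane that closes up in the quotient defines a closed curve. -/
def closedCurve (L : ℝ → PuncturedPlane) (hL : Continuous L)
    (hper : ∀ t, pillowSetoid.r (L (t + 1)) (L t)) : ClosedCurve where
  toFun := Function.Periodic.lift (f := fun t => proj (L t)) (c := (1 : ℝ))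
    (fun t => Quotient.sound (hper t))
  continuous_toFun := by
    refine continuous_coinduced_dom.mpr ?_
    exact continuous_proj.comp hL

/-! ## The staircase function -/

/-- The continuous function that is equal to the integer `n` on `[n - 1/4, n + 1/4]` and affine
of slope `2` on `[n + 1/4, n + 3/4]`. -/
def stair (x : ℝ) : ℝ := ⌊x⌋ + max 0 (min 1 (2 * Int.fract x - 1 / 2))

theorem stair_intCast (n : ℤ) : stair n = n := by
  simp [stair]

theorem stair_add_intCast (x : ℝ) (n : ℤ) : stair (x + n) = stair x + n := by
  simp only [stair, Int.floor_add_intCast, Int.fract_add_intCast]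
  push_cast
  ring

theorem stair_neg (x : ℝ) : stair (-x) = -stair x := by
  by_cases hx : Int.fract x = 0
  · obtain ⟨n, rfl⟩ : ∃ n : ℤ, x = n := ⟨⌊x⌋, by have := Int.floor_add_fract x; linarith⟩
    rw [← Int.cast_neg, stair_intCast, stair_intCast, Int.cast_neg]
  · have h1 : Int.fract (-x) = 1 - Int.fract x := Int.fract_neg hx
    have h2 : (⌊-x⌋ : ℝ) = -⌊x⌋ - 1 := by
      have ha := Int.floor_add_fract x
      have hb := Int.floor_add_fract (-x)
      linarith
    simp only [stair, h1, h2]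
    have : max (0 : ℝ) (min 1 (2 * (1 - Int.fract x) - 1 / 2))
        = 1 - max 0 (min 1 (2 * Int.fract x - 1 / 2)) := by
      rcases le_total (2 * Int.fract x - 1 / 2) 0 with h | h
      · rw [min_eq_left (by linarith), max_eq_right zero_le_one, min_eq_right (by linarith),
          max_eq_left h]
        ring
      · rcases le_total 1 (2 * Int.fract x - 1 / 2) with h' | h'
        · rw [min_eq_right (by linarith), max_eq_left (by linarith), min_eq_left h',
            max_eq_right zero_le_one]
          ring
        · rw [min_eq_right (by linarith), max_eq_right (by linarith), min_eq_right h',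
            max_eq_right h]
          ring
    rw [this]
    ring

theorem continuous_stair : Continuous stair := by
  have h : Continuous fun x : ℝ =>
      (fun t : ℝ => max 0 (min 1 (2 * t - 1 / 2)) - t) (Int.fract x) := by
    have hg : Continuous fun t : ℝ => max 0 (min 1 (2 * t - 1 / 2)) - t := by fun_prop
    exact hg.continuousOn.comp_fract'' (by norm_num)
  have h2 : stair = fun x : ℝ => x +
      (fun t : ℝ => max 0 (min 1 (2 * t - 1 / 2)) - t) (Int.fract x) := by
    funext x
    have := Int.floor_add_fract x
    simp only [stair]
    linarith
  rw [h2]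
  exact continuous_id.add h

theorem stair_eq_of_abs_sub_le (x : ℝ) (n : ℤ) (h : |x - n| ≤ 1 / 4) : stair x = n := by
  obtain ⟨h1, h2⟩ := abs_le.mp h
  rcases le_or_gt (n : ℝ) x with h0 | h0
  · have hf : ⌊x⌋ = n := Int.floor_eq_iff.mpr ⟨h0, by linarith⟩
    have hr : Int.fract x = x - n := by rw [← hf]; rfl
    rw [stair, hf, hr, min_eq_right (by linarith), max_eq_left (by linarith), add_zero]
  · have hf : ⌊x⌋ = n - 1 := Int.floor_eq_iff.mpr ⟨by push_cast; linarith, by push_cast; linarith⟩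
    have hr : Int.fract x = x - n + 1 := by
      rw [Int.fract, hf]; push_cast; ring
    rw [stair, hf, hr, min_eq_left (by linarith), max_eq_right zero_le_one]
    push_cast
    ring

theorem stair_eq_of_mem_collar (x : ℝ) (n : ℤ) (h1 : n + 1 / 4 ≤ x) (h2 : x ≤ n + 3 / 4) :
    stair x = n + 2 * (x - (n + 1 / 4)) := by
  have hf : ⌊x⌋ = n := Int.floor_eq_iff.mpr ⟨by linarith, by linarith⟩
  have hr : Int.fract x = x - n := by rw [← hf]; rfl
  rw [stair, hf, hr, min_eq_right (by linarith), max_eq_right (by linarith)]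
  ring

/-! ## The curve with `2q` intersections with the meridian and twist `p` -/

/-- The meridian `x = 1/2`, oriented upwards on the front. -/
def meridian : ClosedCurve :=
  closedCurve (fun t => ⟨(1 / 2, 2 * t), by
      intro m n h
      have h1 : (1 / 2 : ℝ) = m := congrArg Prod.fst h
      have h2 : (1 : ℤ) = 2 * m := by
        have : (1 : ℝ) = 2 * m := by linarith
        exact_mod_cast this
      omega⟩)
    (by fun_prop)
    (fun t => ⟨0, -1, Or.inl ⟨by simp, by push_cast; ring⟩⟩)

/-- The curve of twist `p` that meets the meridian `2q` times.

Take the collar `1/4 ≤ x ≤ 3/4` of the meridian.  The part of the curve in each of the two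
halves `0 ≤ x ≤ 1/4` and `3/4 ≤ x ≤ 1` of the complement of the collar consists of `q` arcs,
symmetric under the front-to-back involution `y ↦ -y`, namely the arcs at heights
`y = ±(2k+1)/(2q)`, which join the boundary of the half to itself across the folded edge `x = 0` or
`x = 1`.  On either boundary circle this gives the endpoints `X^k` at height `(2k+1)/(2q)`, with `k`
taken modulo `2q`, numbered in the upward direction from the foot `y = 0` of the
perpendicular from the negative cone point.  In the collar the endpoint `X^k` on the left is joined
to the endpoint `X^(k+p)` on the right by an arc that climbs through `p` slots, that is by the
height `p/q`.

Starting with the endpoint `X^0` and following these arcs, unfolded into the plane, gives the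
path `x ↦ (x, 1/(2q) + (p/q) * stair x)`, which closes up in the sphere when `x` has advanced by
`2q`.  (For `p` and `q` coprime it does not close up before.)  For `q = 0` the curve is the
meridian itself. -/
def gamma (p q : ℤ) : ClosedCurve :=
  if hq : q = 0 then meridian else
  closedCurve
    (fun t => ⟨(2 * q * t, 1 / (2 * q) + (p / q : ℝ) * stair (2 * q * t)), by
      intro m n h
      have hq' : (q : ℝ) ≠ 0 := by exact_mod_cast hq
      have h1 : 2 * (q : ℝ) * t = m := congrArg Prod.fst h
      have h2 : 1 / (2 * (q : ℝ)) + (p / q : ℝ) * stair (2 * q * t) = n := congrArg Prod.snd h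
      rw [h1, stair_intCast] at h2
      field_simp at h2
      have h3 : (1 : ℤ) + 2 * (p * m) = 2 * (q * n) := by
        have : (1 : ℝ) + 2 * (p * m) = 2 * (q * n) := by linarith
        exact_mod_cast this
      omega⟩)
    (by
      have := continuous_stair
      fun_prop)
    (fun t => by
      have hq' : (q : ℝ) ≠ 0 := by exact_mod_cast hq
      refine ⟨-q, -p, Or.inl ⟨by push_cast; ring, ?_⟩⟩
      have h : 2 * (q : ℝ) * (t + 1) = 2 * q * t + ((2 * q : ℤ) : ℝ) := by push_cast; ring
      simp only [h, stair_add_intCast]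
      push_cast
      field_simp
      ring)

/-! ## Twists -/

/-- The twist about the meridian on the punctured plane, `(x, y) ↦ (x, y + stair x)`. -/
def twistLift : PuncturedPlane ≃ₜ PuncturedPlane where
  toFun v := ⟨(v.1.1, v.1.2 + stair v.1.1), by
    intro m n h
    have h1 : v.1.1 = m := congrArg Prod.fst h
    have h2 : v.1.2 + stair v.1.1 = n := congrArg Prod.snd h
    rw [h1, stair_intCast] at h2
    exact v.2 m (n - m) (Prod.ext h1 (by push_cast; linarith))⟩
  invFun v := ⟨(v.1.1, v.1.2 - stair v.1.1), by
    intro m n h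
    have h1 : v.1.1 = m := congrArg Prod.fst h
    have h2 : v.1.2 - stair v.1.1 = n := congrArg Prod.snd h
    rw [h1, stair_intCast] at h2
    exact v.2 m (n + m) (Prod.ext h1 (by push_cast; linarith))⟩
  left_inv v := by ext <;> simp
  right_inv v := by ext <;> simp
  continuous_toFun := by
    have := continuous_stair
    fun_prop
  continuous_invFun := by
    have := continuous_stair
    fun_prop

/-- The (half) Dehn twist about the meridian.  It is the identity on `0 ≤ x ≤ 1/4`; on the other
side `3/4 ≤ x ≤ 1` it is `(x, y) ↦ (x, y + 1)`, which interchanges the two cone points on that side;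
and in the collar `1/4 ≤ x ≤ 3/4` it turns through a half turn, upwards on the front.  Its square is
the full Dehn twist about the meridian, `y ↦ y + 2 * stair x`, supported in the collar. -/
def meridianTwist : Sphere4 ≃ₜ Sphere4 :=
  descend twistLift
    (by
      rintro v w ⟨m, n, ⟨h1, h2⟩ | ⟨h1, h2⟩⟩
      · refine ⟨m, n + m, Or.inl ⟨h1, ?_⟩⟩
        change w.1.2 + stair w.1.1 = v.1.2 + stair v.1.1 + 2 * ((n + m : ℤ) : ℝ)
        have h : v.1.1 + 2 * (m : ℝ) = v.1.1 + ((2 * m : ℤ) : ℝ) := by push_cast; ring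
        rw [h1, h2, h, stair_add_intCast]
        push_cast
        ring
      · refine ⟨m, n + m, Or.inr ⟨h1, ?_⟩⟩
        change w.1.2 + stair w.1.1 = -(v.1.2 + stair v.1.1) + 2 * ((n + m : ℤ) : ℝ)
        have h : -v.1.1 + 2 * (m : ℝ) = -v.1.1 + ((2 * m : ℤ) : ℝ) := by push_cast; ring
        rw [h1, h2, h, stair_add_intCast, stair_neg]
        push_cast
        ring)
    (by
      rintro v w ⟨m, n, ⟨h1, h2⟩ | ⟨h1, h2⟩⟩
      · refine ⟨m, n - m, Or.inl ⟨h1, ?_⟩⟩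
        change w.1.2 - stair w.1.1 = v.1.2 - stair v.1.1 + 2 * ((n - m : ℤ) : ℝ)
        have h : v.1.1 + 2 * (m : ℝ) = v.1.1 + ((2 * m : ℤ) : ℝ) := by push_cast; ring
        rw [h1, h2, h, stair_add_intCast]
        push_cast
        ring
      · refine ⟨m, n - m, Or.inr ⟨h1, ?_⟩⟩
        change w.1.2 - stair w.1.1 = -(v.1.2 - stair v.1.1) + 2 * ((n - m : ℤ) : ℝ)
        have h : -v.1.1 + 2 * (m : ℝ) = -v.1.1 + ((2 * m : ℤ) : ℝ) := by push_cast; ring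
        rw [h1, h2, h, stair_add_intCast, stair_neg]
        push_cast
        ring)

/-- The quarter turn `(x, y) ↦ (-y, x)` of the punctured plane. -/
def quarterTurnLift : PuncturedPlane ≃ₜ PuncturedPlane where
  toFun v := ⟨(-v.1.2, v.1.1), by
    intro m n h
    have h1 : -v.1.2 = m := congrArg Prod.fst h
    have h2 : v.1.1 = n := congrArg Prod.snd h
    exact v.2 n (-m) (Prod.ext h2 (by push_cast; linarith))⟩
  invFun v := ⟨(v.1.2, -v.1.1), by
    intro m n h
    have h1 : v.1.2 = m := congrArg Prod.fst h
    have h2 : -v.1.1 = n := congrArg Prod.snd h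
    exact v.2 (-n) m (Prod.ext (by push_cast; linarith) h1)⟩
  left_inv v := by ext <;> simp
  right_inv v := by ext <;> simp
  continuous_toFun := by fun_prop
  continuous_invFun := by fun_prop

/-- The quarter turn of the four-punctured sphere.  It is orientation preserving and carries the
meridian `gamma 1 0` to the curve `gamma 0 1`, with the opposite orientation. -/
def quarterTurn : Sphere4 ≃ₜ Sphere4 :=
  descend quarterTurnLift
    (by
      rintro v w ⟨m, n, ⟨h1, h2⟩ | ⟨h1, h2⟩⟩
      · exact ⟨-n, m, Or.inl ⟨by simp [quarterTurnLift, h2]; ring, h1⟩⟩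
      · exact ⟨-n, m, Or.inr ⟨by simp [quarterTurnLift, h2]; ring, h1⟩⟩)
    (by
      rintro v w ⟨m, n, ⟨h1, h2⟩ | ⟨h1, h2⟩⟩
      · exact ⟨n, -m, Or.inl ⟨h2, by simp [quarterTurnLift, h1]; ring⟩⟩
      · exact ⟨n, -m, Or.inr ⟨h2, by simp [quarterTurnLift, h1]; ring⟩⟩)

/-- The (half) Dehn twist about the curve `f(∂m)`, where `∂m` is the meridian and `f` is an
orientation-preserving homeomorphism: the standard twist transported by `f`, so that its collar is
the image under `f` of the standard collar. -/
def twistAbout (f : Sphere4 ≃ₜ Sphere4) : Sphere4 ≃ₜ Sphere4 := f * meridianTwist * f⁻¹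

/-! ## The tree of curves

A fraction `p/q` is written as the pair `(p, q)`, which is determined up to sign. -/

/-- `Vertex u v f` says that the tree has a vertex whose three adjacent curves are
`f(γ_{1/0})`, `f(γ_{0/1})` and `f(γ_{1/1})`, with the Farey labels `u`, `v` and `u + v`.

The initial vertex carries the initial triple of curves with the labels `1/0, 0/1, 1/1`.  From a
vertex one moves to a neighbouring one across an edge by a twist, in either of the two directions,
about the first or about the second curve of the triple.  A twist about the first curve fixes this
curve.  In one direction it carries the second curve to the third one, and the third one to the new
curve, with label `2u + v`, at the opposite end of the edge labelled `u, u + v`; in the other direction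
it carries the third curve to the second one, and the second one to the new curve, with label
`v - u`, at the opposite end of the edge labelled `u, v`.  Likewise for the second curve, to which
the meridian is carried by `f * quarterTurn`. -/
inductive Vertex : ℤ × ℤ → ℤ × ℤ → (Sphere4 ≃ₜ Sphere4) → Prop
  | initial : Vertex (1, 0) (0, 1) 1
  | fst_pos {u v : ℤ × ℤ} {f : Sphere4 ≃ₜ Sphere4} (h : Vertex u v f) :
      Vertex u (v + u) (twistAbout f * f)
  | fst_neg {u v : ℤ × ℤ} {f : Sphere4 ≃ₜ Sphere4} (h : Vertex u v f) :
      Vertex u (v - u) ((twistAbout f)⁻¹ * f)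
  | snd_pos {u v : ℤ × ℤ} {f : Sphere4 ≃ₜ Sphere4} (h : Vertex u v f) :
      Vertex (u - v) v (twistAbout (f * quarterTurn) * f)
  | snd_neg {u v : ℤ × ℤ} {f : Sphere4 ≃ₜ Sphere4} (h : Vertex u v f) :
      Vertex (u + v) v ((twistAbout (f * quarterTurn))⁻¹ * f)

/-- The pair `w` represents the fraction `p/q`. -/
def Represents (w : ℤ × ℤ) (p q : ℤ) : Prop := w = (p, q) ∨ w = (-p, -q)

/-- The closed curve `c` is in Farey position `p/q` on the tree: at some vertex of the tree it is
one of the three adjacent curves, with label `p/q`. -/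
def FareyPosition (p q : ℤ) (c : ClosedCurve) : Prop :=
  ∃ (u v : ℤ × ℤ) (f : Sphere4 ≃ₜ Sphere4), Vertex u v f ∧
    ((Represents u p q ∧ c = image f (gamma 1 0)) ∨
     (Represents v p q ∧ c = image f (gamma 0 1)) ∨
     (Represents (u + v) p q ∧ c = image f (gamma 1 1)))

end FareyCurves

end

/-!
Every curve is compared with a straight one.  A closed curve in the four-punctured sphere has a lift
to the punctured plane, and two lifts with the same holonomy are homotopic as soon as the segments
between corresponding points miss the lattice (`homotopic_of_segments_avoid`).  The staircase agrees
with the identity at the integers, so such straight-line homotopies replace `stair x` by `x`: they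
show that `gamma p q` is the straight curve `lineCurve (p, q)` (`gamma_sameCurve_lineCurve`) and that
the meridian twist acts on straight curves as the shear `(x, y) ↦ (x, y + x)`
(`actsLinearly_meridianTwist`).  The homeomorphism at a vertex with labels `u, v` is a product of
meridian twists and of their conjugates by the quarter turn, and it therefore carries the straight
curve with label `w` to the one with label `w.1 • u + w.2 • v` (`Vertex.actsLinearly`).

Straight curves are well defined by their labels: the lines that occur satisfy `q y - p x = 1/2`, a
normalisation which all these maps preserve since they have determinant one, and such a line can
slide along itself.  A change of sign of the label is realised by the rotation through `π`.

For the existence of a curve in every Farey position, the vertices are closed under products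
(`Vertex.mul`).  The four elementary moves thus act on the labels that occur by the steps of the
Euclidean algorithm, which reduces every coprime pair to `1/0` or `0/1`.
-/

namespace FareyCurves

/-! ### Closed curves given by lifts -/

theorem closedCurve_congr {L L' : ℝ → PuncturedPlane} {hL : Continuous L} {hL' : Continuous L'}
    {hper : ∀ t, pillowSetoid.r (L (t + 1)) (L t)} {hper' : ∀ t, pillowSetoid.r (L' (t + 1)) (L' t)}
    (h : ∀ t, pillowSetoid.r (L t) (L' t)) : closedCurve L hL hper = closedCurve L' hL' hper' := by
  ext x
  induction x using QuotientAddGroup.induction_on with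
  | H t => exact Quotient.sound (h t)

/-- Two closed curves whose lifts have the same holonomy `(2m, 2n)` are homotopic as soon as the
segments joining corresponding points of the lifts avoid the lattice. -/
theorem homotopic_of_segments_avoid {L₀ L₁ : ℝ → PuncturedPlane} {h₀ : Continuous L₀}
    {h₁ : Continuous L₁} {hper₀ : ∀ t, pillowSetoid.r (L₀ (t + 1)) (L₀ t)}
    {hper₁ : ∀ t, pillowSetoid.r (L₁ (t + 1)) (L₁ t)} (m n : ℤ)
    (hol₀ : ∀ t, (L₀ (t + 1)).1 = (L₀ t).1 + (2 * (m : ℝ), 2 * (n : ℝ)))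
    (hol₁ : ∀ t, (L₁ (t + 1)).1 = (L₁ t).1 + (2 * (m : ℝ), 2 * (n : ℝ)))
    (avoid : ∀ s t : ℝ, ∀ i j : ℤ, (1 - s) • (L₀ t).1 + s • (L₁ t).1 ≠ ((i : ℝ), (j : ℝ))) :
    (closedCurve L₀ h₀ hper₀).Homotopic (closedCurve L₁ h₁ hper₁) := by
  let K : ℝ × ℝ → PuncturedPlane := fun x => ⟨_, avoid x.1 x.2⟩
  have hK : Continuous K := by fun_prop
  have hKper (s : ℝ) : Function.Periodic (fun t => proj (K (s, t))) 1 := fun t =>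
    Quotient.sound ⟨-m, -n, Or.inl (by
      simp only [K, hol₀, hol₁, Prod.fst_add, Prod.snd_add, Prod.smul_fst, Prod.smul_snd,
        smul_eq_mul]
      push_cast
      constructor <;> ring)⟩
  have hq : IsOpenQuotientMap
      (Prod.map (id : unitInterval → unitInterval) (QuotientAddGroup.mk : ℝ → AddCircle (1 : ℝ))) :=
    IsOpenQuotientMap.id.prodMap QuotientAddGroup.isOpenQuotientMap_mk
  refine ⟨⟨⟨fun x => (hKper x.1).lift x.2, ?_⟩, fun x => ?_, fun x => ?_⟩⟩
  · rw [hq.isQuotientMap.continuous_iff]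
    exact continuous_proj.comp
      (hK.comp ((continuous_subtype_val.comp continuous_fst).prodMk continuous_snd))
  · induction x using QuotientAddGroup.induction_on with
    | H t => exact congrArg proj (Subtype.ext (by simp [K]))
  · induction x using QuotientAddGroup.induction_on with
    | H t => exact congrArg proj (Subtype.ext (by simp [K]))

/-- Two lifts with the same abscissa which agree wherever the abscissa is an integer define
homotopic curves. -/
theorem homotopic_of_vertical {L₀ L₁ : ℝ → PuncturedPlane} {h₀ : Continuous L₀}
    {h₁ : Continuous L₁} {hper₀ : ∀ t, pillowSetoid.r (L₀ (t + 1)) (L₀ t)}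
    {hper₁ : ∀ t, pillowSetoid.r (L₁ (t + 1)) (L₁ t)} (m n : ℤ)
    (hol₀ : ∀ t, (L₀ (t + 1)).1 = (L₀ t).1 + (2 * (m : ℝ), 2 * (n : ℝ)))
    (hol₁ : ∀ t, (L₁ (t + 1)).1 = (L₁ t).1 + (2 * (m : ℝ), 2 * (n : ℝ)))
    (fst_eq : ∀ t, (L₀ t).1.1 = (L₁ t).1.1)
    (snd_eq : ∀ t, ∀ i : ℤ, (L₀ t).1.1 = i → (L₀ t).1.2 = (L₁ t).1.2) :
    (closedCurve L₀ h₀ hper₀).Homotopic (closedCurve L₁ h₁ hper₁) := by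
  refine homotopic_of_segments_avoid m n hol₀ hol₁ fun s t i j h => ?_
  have hx : (L₀ t).1.1 = i := by
    have := congrArg Prod.fst h
    simp only [Prod.fst_add, Prod.smul_fst, smul_eq_mul, ← fst_eq] at this
    linarith
  have hL : (L₀ t).1 = (L₁ t).1 := Prod.ext (fst_eq t) (snd_eq t i hx)
  rw [← hL, ← add_smul, sub_add_cancel, one_smul] at h
  exact (L₀ t).2 i j h

/-! ### Unoriented curves up to homotopy -/

theorem reverse_reverse (c : ClosedCurve) : reverse (reverse c) = c := by
  ext x
  simp [reverse]

theorem Homotopic.reverse {c d : ClosedCurve} (h : c.Homotopic d) :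
    (reverse c).Homotopic (reverse d) :=
  h.comp (.refl _)

theorem Homotopic.image {c d : ClosedCurve} (f : Sphere4 ≃ₜ Sphere4) (h : c.Homotopic d) :
    (image f c).Homotopic (image f d) :=
  ContinuousMap.Homotopic.comp (.refl _) h

theorem SameCurve.symm {c d : ClosedCurve} (h : SameCurve c d) : SameCurve d c := by
  rcases h with h | h
  · exact Or.inl h.symm
  · have := Homotopic.reverse h.symm
    rw [reverse_reverse] at this
    exact Or.inr this

theorem SameCurve.trans {c d e : ClosedCurve} (h : SameCurve c d) (h' : SameCurve d e) :
    SameCurve c e := by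
  rcases h with h | h <;> rcases h' with h' | h'
  · exact Or.inl (h.trans h')
  · exact Or.inr (h.trans h')
  · exact Or.inr (h.trans (Homotopic.reverse h'))
  · have := Homotopic.reverse h'
    rw [reverse_reverse] at this
    exact Or.inl (h.trans this)

theorem SameCurve.image {c d : ClosedCurve} (f : Sphere4 ≃ₜ Sphere4) (h : SameCurve c d) :
    SameCurve (image f c) (image f d) :=
  h.imp (Homotopic.image f) (Homotopic.image f)

/-! ### Straight curves -/

/-- The straight closed curve of slope `w.1 / w.2`, with lift `t ↦ a + 2t (w.2, w.1)`.  The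
determinant condition on the base point `a` puts the line halfway between two adjacent parallel
lines that can carry lattice points. -/
def lineCurve (w : ℤ × ℤ) (a : ℝ × ℝ) (h : w.2 * a.2 - w.1 * a.1 = 1 / 2) : ClosedCurve :=
  closedCurve
    (fun t => ⟨(a.1 + 2 * w.2 * t, a.2 + 2 * w.1 * t), by
      intro m n e
      have h1 : a.1 + 2 * (w.2 : ℝ) * t = m := congrArg Prod.fst e
      have h2 : a.2 + 2 * (w.1 : ℝ) * t = n := congrArg Prod.snd e
      have h3 : 2 * (w.2 * n - w.1 * m) = 1 := by
        have : 2 * ((w.2 : ℝ) * n - w.1 * m) = 1 := by rw [← h1, ← h2]; linarith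
        exact_mod_cast this
      omega⟩)
    (by fun_prop)
    (fun t => ⟨-w.2, -w.1, Or.inl ⟨by push_cast; ring, by push_cast; ring⟩⟩)

/-- Sliding the base point along the line does not change the homotopy class. -/
theorem lineCurve_homotopic (w : ℤ × ℤ) {a b : ℝ × ℝ} (ha : w.2 * a.2 - w.1 * a.1 = 1 / 2)
    (hb : w.2 * b.2 - w.1 * b.1 = 1 / 2) : (lineCurve w a ha).Homotopic (lineCurve w b hb) := by
  refine homotopic_of_segments_avoid w.2 w.1 (fun t => ?_) (fun t => ?_) fun s t i j e => ?_
  · ext <;> simp <;> ring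
  · ext <;> simp <;> ring
  · have h1 := congrArg Prod.fst e
    have h2 := congrArg Prod.snd e
    simp only [Prod.fst_add, Prod.snd_add, Prod.smul_fst, Prod.smul_snd, smul_eq_mul] at h1 h2
    have h3 : 2 * (w.2 * j - w.1 * i) = 1 := by
      have : 2 * ((w.2 : ℝ) * j - w.1 * i) = 1 := by
        rw [← h1, ← h2]
        linear_combination 2 * (1 - s) * ha + 2 * s * hb
      exact_mod_cast this
    omega

/-- The rotation through `π` about the origin identifies the lines with labels `w` and `-w`. -/
theorem lineCurve_neg (w : ℤ × ℤ) (a : ℝ × ℝ) (h : w.2 * a.2 - w.1 * a.1 = 1 / 2)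
    (h' : (-w).2 * (-a).2 - (-w).1 * (-a).1 = (1 / 2 : ℝ)) :
    lineCurve (-w) (-a) h' = lineCurve w a h :=
  closedCurve_congr fun t => ⟨0, 0, Or.inr (by simp; constructor <;> ring)⟩

theorem sameCurve_lineCurve_of_represents {w : ℤ × ℤ} {p q : ℤ} (hw : Represents w p q)
    {a b : ℝ × ℝ} (ha : w.2 * a.2 - w.1 * a.1 = 1 / 2) (hb : q * b.2 - p * b.1 = 1 / 2) :
    SameCurve (lineCurve w a ha) (lineCurve (p, q) b hb) := by
  rcases hw with rfl | rfl
  · exact Or.inl (lineCurve_homotopic _ ha hb)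
  · have hb' : (-(p, q)).2 * (-b).2 - (-(p, q)).1 * (-b).1 = (1 / 2 : ℝ) := by
      simp; linarith
    exact Or.inl (lineCurve_neg (p, q) b hb hb' ▸ lineCurve_homotopic _ ha hb')

theorem meridian_eq_reverse_lineCurve (h : ((1, 0) : ℤ × ℤ).2 * ((-1 / 2, 0) : ℝ × ℝ).2 -
      ((1, 0) : ℤ × ℤ).1 * ((-1 / 2, 0) : ℝ × ℝ).1 = 1 / 2) :
    meridian = reverse (lineCurve (1, 0) (-1 / 2, 0) h) := by
  ext x
  induction x using QuotientAddGroup.induction_on with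
  | H t => exact Quotient.sound ⟨0, 0, Or.inr ⟨by simp; norm_num, by simp⟩⟩

/-- Straightening the staircase: `gamma p q` is the straight curve of slope `p / q`. -/
theorem gamma_sameCurve_lineCurve {p q : ℤ} (hpq : IsCoprime p q) :
    ∃ a h, SameCurve (gamma p q) (lineCurve (p, q) a h) := by
  by_cases hq : q = 0
  · subst hq
    have hm : SameCurve meridian (lineCurve (1, 0) (-1 / 2, 0) (by simp; norm_num)) :=
      Or.inr (by rw [meridian_eq_reverse_lineCurve (by simp; norm_num)])
    have hg : gamma p 0 = meridian := dif_pos rfl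
    rw [hg]
    rcases Int.isUnit_iff.mp (isCoprime_zero_right.mp hpq) with rfl | rfl
    · exact ⟨_, _, hm⟩
    · refine ⟨(1 / 2, 0), by norm_num, hm.trans ?_⟩
      exact sameCurve_lineCurve_of_represents (Or.inr (by simp)) _ _
  · have hq' : (q : ℝ) ≠ 0 := by exact_mod_cast hq
    refine ⟨(0, 1 / (2 * q)), by field_simp; simp, Or.inl ?_⟩
    rw [gamma, dif_neg hq]
    refine homotopic_of_vertical q p (fun t => ?_) (fun t => ?_) (fun t => ?_) fun t i e => ?_
    · have h : 2 * (q : ℝ) * (t + 1) = 2 * q * t + ((2 * q : ℤ) : ℝ) := by push_cast; ring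
      simp only [h, stair_add_intCast]
      ext
      · simp
      · simp
        field_simp
        ring
    · ext <;> simp <;> ring
    · simp
    · simp only at e ⊢
      rw [e, stair_intCast, ← e]
      field_simp

/-! ### Twists of straight curves -/

theorem image_closedCurve (F : PuncturedPlane ≃ₜ PuncturedPlane) {h h'}
    {L : ℝ → PuncturedPlane} {hL : Continuous L} {hper} :
    image (descend F h h') (closedCurve L hL hper) =
      closedCurve (fun t => F (L t)) (F.continuous.comp hL) fun t => h _ _ (hper t) := by
  ext x
  induction x using QuotientAddGroup.induction_on with
  | H t => rfl

/-- The linear action of a homeomorphism: `f` carries straight curves to straight curves, up to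
homotopy, and acts on their labels by the linear map that sends `(1, 0)` to `u` and `(0, 1)` to
`v`. -/
def ActsLinearly (f : Sphere4 ≃ₜ Sphere4) (u v : ℤ × ℤ) : Prop :=
  ∀ w a h, ∃ b h', (image f (lineCurve w a h)).Homotopic
    (lineCurve (w.1 • u + w.2 • v) b h')

theorem exists_homotopic_lineCurve_congr {w w' : ℤ × ℤ} {c : ClosedCurve} (e : w = w')
    (h : ∃ b h', c.Homotopic (lineCurve w b h')) : ∃ b h', c.Homotopic (lineCurve w' b h') :=
  e ▸ h

theorem actsLinearly_one : ActsLinearly 1 (1, 0) (0, 1) := fun w a h =>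
  exists_homotopic_lineCurve_congr (by ext <;> simp) ⟨a, h, ContinuousMap.Homotopic.refl _⟩

theorem twistLift_apply (v : PuncturedPlane) :
    (twistLift v).1 = (v.1.1, v.1.2 + stair v.1.1) := rfl

/-- The meridian twist acts as the shear `(x, y) ↦ (x, y + x)`. -/
theorem actsLinearly_meridianTwist : ActsLinearly meridianTwist (1, 0) (1, 1) := by
  intro w a h
  refine exists_homotopic_lineCurve_congr (w := (w.1 + w.2, w.2)) (by ext <;> simp)
    ⟨(a.1, a.2 + a.1), by push_cast; linarith, ?_⟩
  have e : image meridianTwist (lineCurve w a h) = _ := image_closedCurve twistLift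
  rw [e]
  refine homotopic_of_vertical w.2 (w.1 + w.2) (fun t => ?_) (fun t => ?_) (fun t => rfl)
    fun t i e => ?_
  · have h : a.1 + 2 * (w.2 : ℝ) * (t + 1) = a.1 + 2 * w.2 * t + ((2 * w.2 : ℤ) : ℝ) := by
      push_cast; ring
    simp only [twistLift_apply, h, stair_add_intCast]
    ext <;> simp <;> ring
  · ext <;> simp <;> ring
  · simp only [twistLift_apply] at e ⊢
    rw [e, stair_intCast, ← e]
    push_cast
    ring

theorem actsLinearly_quarterTurn : ActsLinearly quarterTurn (0, -1) (1, 0) := by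
  intro w a h
  refine exists_homotopic_lineCurve_congr (w := (w.2, -w.1)) (by ext <;> simp)
    ⟨(-a.2, a.1), by push_cast; linarith, ?_⟩
  have e : image quarterTurn (lineCurve w a h) =
      lineCurve (w.2, -w.1) (-a.2, a.1) (by push_cast; linarith) :=
    (image_closedCurve quarterTurnLift).trans
      (closedCurve_congr fun t => ⟨0, 0, Or.inl (by simp [quarterTurnLift]; ring)⟩)
  rw [e]

theorem ActsLinearly.mul {f g : Sphere4 ≃ₜ Sphere4} {u v x y : ℤ × ℤ}
    (hf : ActsLinearly f u v) (hg : ActsLinearly g x y) :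
    ActsLinearly (f * g) (x.1 • u + x.2 • v) (y.1 • u + y.2 • v) := by
  intro w a h
  obtain ⟨b, hb, e⟩ := hg w a h
  obtain ⟨c, hc, e'⟩ := hf _ b hb
  refine exists_homotopic_lineCurve_congr ?_ ⟨c, hc, (Homotopic.image f e).trans e'⟩
  ext <;> simp <;> ring

theorem exists_basePoint {w : ℤ × ℤ} (hw : w ≠ 0) :
    ∃ a : ℝ × ℝ, w.2 * a.2 - w.1 * a.1 = 1 / 2 := by
  by_cases h : w.2 = 0
  · have h' : (w.1 : ℝ) ≠ 0 := by
      exact_mod_cast fun h' => hw (Prod.ext h' h)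
    exact ⟨(-1 / (2 * w.1), 0), by field_simp; simp⟩
  · have h' : (w.2 : ℝ) ≠ 0 := by exact_mod_cast h
    exact ⟨(0, 1 / (2 * w.2)), by field_simp; simp⟩

/-- The inverse homeomorphism acts by the inverse matrix. -/
theorem ActsLinearly.inv {f : Sphere4 ≃ₜ Sphere4} {u v x y : ℤ × ℤ} (hf : ActsLinearly f u v)
    (hx : x.1 • u + x.2 • v = (1, 0)) (hy : y.1 • u + y.2 • v = (0, 1)) :
    ActsLinearly f⁻¹ x y := by
  intro w a h
  have key : (w.1 • x + w.2 • y).1 • u + (w.1 • x + w.2 • y).2 • v = w := by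
    calc _ = w.1 • (x.1 • u + x.2 • v) + w.2 • (y.1 • u + y.2 • v) := by
          ext <;> simp <;> ring
      _ = w := by rw [hx, hy]; ext <;> simp
  have hne : w.1 • x + w.2 • y ≠ 0 := by
    intro h0
    rw [h0] at key
    rw [← key] at h
    norm_num at h
  obtain ⟨b, hb⟩ := exists_basePoint hne
  obtain ⟨c, hc, e⟩ := exists_homotopic_lineCurve_congr key (hf _ b hb)
  have e' := Homotopic.image f⁻¹ ((lineCurve_homotopic w h hc).trans e.symm)
  refine ⟨b, hb, ?_⟩
  have e'' : image f⁻¹ (image f (lineCurve _ b hb)) = lineCurve _ b hb :=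
    ContinuousMap.ext fun t => f.symm_apply_apply _
  rwa [e''] at e'

/-! ### The vertices of the tree -/

theorem twistAbout_mul (f : Sphere4 ≃ₜ Sphere4) : twistAbout f * f = f * meridianTwist := by
  simp [twistAbout]

theorem twistAbout_inv_mul (f : Sphere4 ≃ₜ Sphere4) :
    (twistAbout f)⁻¹ * f = f * meridianTwist⁻¹ := by
  simp [twistAbout, mul_assoc]

theorem twistAbout_quarterTurn_mul (f : Sphere4 ≃ₜ Sphere4) :
    twistAbout (f * quarterTurn) * f = f * (quarterTurn * meridianTwist * quarterTurn⁻¹) := by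
  simp [twistAbout, mul_assoc]

theorem twistAbout_quarterTurn_inv_mul (f : Sphere4 ≃ₜ Sphere4) :
    (twistAbout (f * quarterTurn))⁻¹ * f =
      f * (quarterTurn * meridianTwist * quarterTurn⁻¹)⁻¹ := by
  simp [twistAbout, mul_assoc]

theorem actsLinearly_quarterTurn_conj :
    ActsLinearly (quarterTurn * meridianTwist * quarterTurn⁻¹) (1, -1) (0, 1) := by
  have := (actsLinearly_quarterTurn.mul actsLinearly_meridianTwist).mul
    (actsLinearly_quarterTurn.inv (x := (0, 1)) (y := (-1, 0)) (by simp) (by simp))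
  simpa using this

theorem Vertex.actsLinearly {u v : ℤ × ℤ} {f : Sphere4 ≃ₜ Sphere4} (h : Vertex u v f) :
    ActsLinearly f u v := by
  induction h with
  | initial => exact actsLinearly_one
  | fst_pos _ ih =>
    rw [twistAbout_mul]
    simpa [add_comm] using ih.mul actsLinearly_meridianTwist
  | fst_neg _ ih =>
    rw [twistAbout_inv_mul]
    simpa [sub_eq_neg_add] using ih.mul
      (actsLinearly_meridianTwist.inv (x := (1, 0)) (y := (-1, 1)) (by simp) (by simp))
  | snd_pos _ ih =>
    rw [twistAbout_quarterTurn_mul]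
    simpa [sub_eq_add_neg] using ih.mul actsLinearly_quarterTurn_conj
  | snd_neg _ ih =>
    rw [twistAbout_quarterTurn_inv_mul]
    simpa using ih.mul
      (actsLinearly_quarterTurn_conj.inv (x := (1, 1)) (y := (0, 1)) (by simp) (by simp))

/-- The homeomorphism at a vertex carries `gamma p₀ q₀` to the curve `gamma p q` of the fraction
that the image label represents. -/
theorem image_gamma_sameCurve {u v : ℤ × ℤ} {f : Sphere4 ≃ₜ Sphere4} (h : Vertex u v f)
    {p q p₀ q₀ : ℤ} (hpq : IsCoprime p q) (hpq₀ : IsCoprime p₀ q₀)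
    (hw : Represents (p₀ • u + q₀ • v) p q) :
    SameCurve (image f (gamma p₀ q₀)) (gamma p q) := by
  obtain ⟨a₀, h₀, e₀⟩ := gamma_sameCurve_lineCurve hpq₀
  obtain ⟨a, ha, e⟩ := gamma_sameCurve_lineCurve hpq
  obtain ⟨b, hb, e'⟩ := h.actsLinearly (p₀, q₀) a₀ h₀
  exact ((e₀.image f).trans (Or.inl e')).trans
    ((sameCurve_lineCurve_of_represents hw hb ha).trans e.symm)

/-- The vertices are closed under products of the homeomorphisms and of the label matrices. -/
theorem Vertex.mul {x y u v : ℤ × ℤ} {g f : Sphere4 ≃ₜ Sphere4} (hg : Vertex x y g)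
    (hf : Vertex u v f) : Vertex (u.1 • x + u.2 • y) (v.1 • x + v.2 • y) (g * f) := by
  induction hf with
  | initial => simpa using hg
  | fst_pos _ ih =>
    rw [twistAbout_mul, ← mul_assoc, ← twistAbout_mul]
    convert ih.fst_pos using 1
    ext <;> simp <;> ring
  | fst_neg _ ih =>
    rw [twistAbout_inv_mul, ← mul_assoc, ← twistAbout_inv_mul]
    convert ih.fst_neg using 1
    ext <;> simp <;> ring
  | snd_pos _ ih =>
    rw [twistAbout_quarterTurn_mul, ← mul_assoc, ← twistAbout_quarterTurn_mul]
    convert ih.snd_pos using 1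
    ext <;> simp <;> ring
  | snd_neg _ ih =>
    rw [twistAbout_quarterTurn_inv_mul, ← mul_assoc, ← twistAbout_quarterTurn_inv_mul]
    convert ih.snd_neg using 1
    ext <;> simp <;> ring

/-! ### Every coprime pair occurs as a label -/

/-- The fraction `p/q` is the first label of some vertex. -/
def IsFirstLabel (p q : ℤ) : Prop :=
  ∃ (u v : ℤ × ℤ) (f : Sphere4 ≃ₜ Sphere4), Vertex u v f ∧ Represents u p q

theorem IsFirstLabel.map {p q : ℤ} (h : IsFirstLabel p q) {x y : ℤ × ℤ} {g : Sphere4 ≃ₜ Sphere4}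
    (hg : Vertex x y g) : IsFirstLabel (p * x.1 + q * y.1) (p * x.2 + q * y.2) := by
  obtain ⟨u, v, f, hf, hu⟩ := h
  refine ⟨_, _, _, hg.mul hf, ?_⟩
  rcases hu with rfl | rfl
  · left
    ext <;> simp
  · right
    ext <;> simp <;> ring

theorem IsFirstLabel.of_sub_left {p q : ℤ} (h : IsFirstLabel (p - q) q) : IsFirstLabel p q := by
  simpa using h.map Vertex.initial.fst_pos

theorem IsFirstLabel.of_add_left {p q : ℤ} (h : IsFirstLabel (p + q) q) : IsFirstLabel p q := by
  simpa using h.map Vertex.initial.fst_neg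

theorem IsFirstLabel.of_add_right {p q : ℤ} (h : IsFirstLabel p (q + p)) : IsFirstLabel p q := by
  simpa using h.map Vertex.initial.snd_pos

theorem IsFirstLabel.of_sub_right {p q : ℤ} (h : IsFirstLabel p (q - p)) : IsFirstLabel p q := by
  simpa using h.map Vertex.initial.snd_neg

theorem IsFirstLabel.neg {p q : ℤ} (h : IsFirstLabel p q) : IsFirstLabel (-p) (-q) := by
  obtain ⟨u, v, f, hf, hu⟩ := h
  exact ⟨u, v, f, hf, by simpa [Represents, or_comm] using hu⟩

theorem isFirstLabel_of_isCoprime (p q : ℤ) (hpq : IsCoprime p q) : IsFirstLabel p q := by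
  have h10 : IsFirstLabel 1 0 := ⟨_, _, _, .initial, Or.inl rfl⟩
  have h01 : IsFirstLabel 0 1 :=
    IsFirstLabel.of_add_left (IsFirstLabel.of_sub_right (by simpa using h10))
  by_cases hp : p = 0
  · subst hp
    rcases Int.isUnit_iff.mp (isCoprime_zero_left.mp hpq) with rfl | rfl
    · exact h01
    · exact h01.neg
  by_cases hq : q = 0
  · subst hq
    rcases Int.isUnit_iff.mp (isCoprime_zero_right.mp hpq) with rfl | rfl
    · exact h10
    · exact h10.neg
  obtain ⟨a, b, hab⟩ := hpq
  -- One of the four Euclidean steps decreases `|p| + |q|`.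
  have step : (p - q).natAbs < p.natAbs ∨ (p + q).natAbs < p.natAbs ∨
      (q - p).natAbs < q.natAbs ∨ (q + p).natAbs < q.natAbs := by omega
  rcases step with h | h | h | h
  · exact (isFirstLabel_of_isCoprime _ _ ⟨a, a + b, by linarith⟩).of_sub_left
  · exact (isFirstLabel_of_isCoprime _ _ ⟨a, b - a, by linarith⟩).of_add_left
  · exact (isFirstLabel_of_isCoprime _ _ ⟨a + b, b, by linarith⟩).of_sub_right
  · exact (isFirstLabel_of_isCoprime _ _ ⟨a - b, b, by linarith⟩).of_add_right
termination_by p.natAbs + q.natAbs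

end FareyCurves

theorem mainTheorem11 (p q : ℤ) (hpq : IsCoprime p q) (hq : 0 ≤ q) :
    (∃ δ : FareyCurves.ClosedCurve, FareyCurves.FareyPosition p q δ) ∧
    ∀ δ : FareyCurves.ClosedCurve, FareyCurves.FareyPosition p q δ →
      FareyCurves.SameCurve δ (FareyCurves.gamma p q) := by
  constructor
  · obtain ⟨u, v, f, hf, hu⟩ := FareyCurves.isFirstLabel_of_isCoprime p q hpq
    exact ⟨_, u, v, f, hf, Or.inl ⟨hu, rfl⟩⟩
  · rintro δ ⟨u, v, f, hf, ⟨hw, rfl⟩ | ⟨hw, rfl⟩ | ⟨hw, rfl⟩⟩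
    · exact FareyCurves.image_gamma_sameCurve hf hpq isCoprime_one_left (by simpa using hw)
    · exact FareyCurves.image_gamma_sameCurve hf hpq isCoprime_one_right (by simpa using hw)
    · exact FareyCurves.image_gamma_sameCurve hf hpq isCoprime_one_left (by simpa using hw)
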